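/- A (finite) hypergraph $H=(V,E)$ consists of a finite vertex set $V$ and a set $E$ of subsets of $V$ (so there are no repeated edges); it is $r$-uniform if every edge has exactly $r$ vertices, and its maximum degree is the largest number of edges containing a common vertex. A balanced separator of $H$ is a set $R\subseteq E$ such that every connected component of $(V,E\setminus R)$ is incident to at most $|E|/2$ edges of $E\setminus R$. For $r\ge 2$ put $\epsilon_r=(1-2^{-1/r})^r$. Theorem. Fix $r\ge 2$. (a) There is a constant $C=C(r)>0$ such that, for all sequences of natural numbers $(k_i)$, $(m_i)$ with $k_i\to\infty$, $m_i\to\infty$ and $k_i=o(m_i)$, there are $r$-uniform hypergraphs $H_i$ with exactly $m_i$ edges and reals $\delta_i\to 0$ such that $H_i$ has maximum degree at most $C k_i$ for all sufficiently large $i$, and every balanced separator of $H_i$ has at least $\left(\tfrac12-\epsilon_r\right)m_i(1-\delta_i)$ edges. (b) Consequently the constant $\epsilon_r$ is tight as a saving for balanced separators: for no $\epsilon>\epsilon_r$ is it true that all hypergraphs with $m\to\infty$ edges, each of size at most $r$, and maximum degree $o(\sqrt m)$ have balanced separators of size at most $\left(\tfrac12-\epsilon\right)m+o(m)$. -/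

import Mathlib

open Filter Topology Asymptotics
open scoped Hypergraph

namespace Hypergraph

/-- All hyperedges have exactly `r` vertices. -/
def IsUniform {α : Type*} (H : Hypergraph α) (r : ℕ) : Prop :=
  ∀ e ∈ E(H), e.ncard = r

/-- The number of hyperedges containing the vertex `v`. -/
noncomputable def degree {α : Type*} (H : Hypergraph α) (v : α) : ℕ :=
  {e ∈ E(H) | v ∈ e}.ncard

/-- The maximum vertex degree; points outside the vertex set have degree `0`. -/
noncomputable def maxDegree {α : Type*} [Fintype α] (H : Hypergraph α) : ℕ :=
  Finset.univ.sup H.degree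

/-- The hypergraph `(V, E \ R)`. -/
def deleteEdges {α : Type*} (H : Hypergraph α) (R : Set (Set α)) : Hypergraph α where
  vertexSet := V(H)
  edgeSet := E(H) \ R
  subset_vertexSet_of_mem_edgeSet' := fun _ he => H.subset_vertexSet_of_mem_edgeSet' he.1

/-- A nonempty set `S` of vertices is connected if any two of its vertices are joined by a sequence
of consecutively intersecting hyperedges, all of them contained in `S` (a single vertex counts as
joined to itself). -/
def IsConnectedSet {α : Type*} (H : Hypergraph α) (S : Set α) : Prop :=
  S ⊆ V(H) ∧ S.Nonempty ∧
    ∀ u ∈ S, ∀ v ∈ S, Relation.ReflTransGen (fun x y => ∃ e ∈ E(H), e ⊆ S ∧ x ∈ e ∧ y ∈ e) u v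

/-- A connected component is a maximal connected set of vertices. -/
def IsComponent {α : Type*} (H : Hypergraph α) (S : Set α) : Prop :=
  Maximal H.IsConnectedSet S

/-- `R ⊆ E` is a balanced separator if every connected component of `(V, E \ R)` is incident to at
most `|E| / 2` hyperedges of `E \ R`. -/
def IsBalancedSeparator {α : Type*} (H : Hypergraph α) (R : Set (Set α)) : Prop :=
  R ⊆ E(H) ∧ ∀ S : Set α, (H.deleteEdges R).IsComponent S →
    ({e ∈ E(H) \ R | (e ∩ S).Nonempty}.ncard : ℝ) ≤ (E(H).ncard : ℝ) / 2

end Hypergraph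

/-- The constant `ε_r = (1 - 2 ^ (-1 / r)) ^ r`. -/
noncomputable def separatorConst (r : ℕ) : ℝ :=
  (1 - (2 : ℝ) ^ (-1 / (r : ℝ))) ^ r

/-- The separator bound with saving `ε`: finite hypergraphs with `m → ∞` hyperedges, each of size at
most `r`, and maximum degree `o(√m)` have balanced separators of size at most
`(1 / 2 - ε) m + o(m)`. -/
def SeparatorBound (r : ℕ) (ε : ℝ) : Prop :=
  ∀ (n : ℕ → ℕ) (H : ∀ i, Hypergraph (Fin (n i))),
    (∀ i, ∀ e ∈ E(H i), e.ncard ≤ r) →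
    Tendsto (fun i => E(H i).ncard) atTop atTop →
    (fun i => ((H i).maxDegree : ℝ)) =o[atTop] (fun i => √(E(H i).ncard : ℝ)) →
    ∃ err : ℕ → ℝ, err =o[atTop] (fun i => (E(H i).ncard : ℝ)) ∧
      ∀ i, ∃ R, (H i).IsBalancedSeparator R ∧
        (R.ncard : ℝ) ≤ (1 / 2 - ε) * (E(H i).ncard : ℝ) + err i

/-! The extremal examples are sparse random hypergraphs: `m` uniformly random `r`-tuples on about `m
/ D` vertices, with `D` a large constant. A set of weight `x` is expected to span `x ^ r * m`
tuples. Exponential moments and a union bound over all vertex sets (`exists_tuples`) show that, for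
some outcome, no set exceeds this by more than `δ * m`. The mean degree is bounded while `k → ∞`, so
few tuples are degenerate or meet a vertex of high degree. These are replaced by disjoint edges on
fresh vertices of weight zero, at a further cost of `δ * m`.

The separator bound is then deterministic (`IsBalancedSeparator.le_ncard`). Put `β = 2 ^ (-1 / r)`,
so `β ^ r = 1 / 2` and `ε_r = (1 - β) ^ r`. After deleting `R`, if some component has weight at
least `β`, balance allows at most `m / 2` edges to meet it, and the others lie in a set of weight at
most `1 - β`. Otherwise some union of components has weight `t ∈ [1 - β, β]`, and every surviving
edge lies in it or in its complement; by convexity `t ^ r + (1 - t) ^ r ≤ β ^ r + (1 - β) ^ r`. In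
both cases about `(1 / 2 + ε_r) * m` edges survive at most. -/

/-- The proportion of the points of `β` that a map `w : β → α` sends into `S`. -/
noncomputable def weight {α β : Type*} [Fintype β] (w : β → α) (S : Set α) : ℝ :=
  ((w ⁻¹' S).ncard : ℝ) / Fintype.card β

section weight

variable {α β : Type*} [Fintype β] (w : β → α)

theorem weight_nonneg (S : Set α) : 0 ≤ weight w S := by
  unfold weight; positivity

theorem weight_empty : weight w ∅ = 0 := by simp [weight]

theorem weight_union_of_disjoint {S T : Set α} (h : Disjoint S T) :
    weight w (S ∪ T) = weight w S + weight w T := by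
  unfold weight
  rw [Set.preimage_union, Set.ncard_union_eq (h.preimage w)]
  push_cast; ring

theorem weight_compl [Nonempty β] (S : Set α) : weight w Sᶜ = 1 - weight w S := by
  have h := weight_union_of_disjoint w (isCompl_compl (x := S)).disjoint
  have h1 : weight w (Set.univ : Set α) = 1 := by
    simp [weight, Set.ncard_univ, Nat.card_eq_fintype_card]
  rw [Set.union_compl_self, h1] at h
  linarith

theorem weight_pos_of_mem {S : Set α} {x : β} (h : w x ∈ S) : 0 < weight w S := by
  unfold weight
  have h1 : 0 < (w ⁻¹' S).ncard := (Set.ncard_pos (Set.toFinite _)).2 ⟨x, h⟩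
  have h2 : 0 < Fintype.card β := Fintype.card_pos_iff.2 ⟨x⟩
  positivity

theorem exists_mem_of_weight_pos {S : Set α} (h : 0 < weight w S) : ∃ x, w x ∈ S := by
  by_contra hne
  have : w ⁻¹' S = ∅ := by
    ext x; simp only [Set.mem_preimage, Set.mem_empty_iff_false, iff_false]
    exact fun hx => hne ⟨x, hx⟩
  simp [weight, this] at h

end weight

/-! ### Components and unions of components -/

namespace Hypergraph

variable {α : Type*}

/-- The vertices reachable from `v` along hyperedges. -/
def reachableSet (H : Hypergraph α) (v : α) : Set α :=
  {u | Relation.ReflTransGen H.Adj v u}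

/-- A set of vertices that no hyperedge crosses. -/
def IsClosedUnderEdges (H : Hypergraph α) (A : Set α) : Prop :=
  ∀ e ∈ E(H), e ⊆ A ∨ e ⊆ Aᶜ

theorem mem_reachableSet_self (H : Hypergraph α) (v : α) : v ∈ H.reachableSet v :=
  Relation.ReflTransGen.refl

theorem subset_reachableSet {H : Hypergraph α} {v x : α} {e : Set α} (he : e ∈ E(H)) (hx : x ∈ e)
    (hv : x ∈ H.reachableSet v) : e ⊆ H.reachableSet v :=
  fun _ hy => Relation.ReflTransGen.tail hv ⟨e, he, hx, hy⟩

theorem isClosedUnderEdges_reachableSet (H : Hypergraph α) (v : α) :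
    H.IsClosedUnderEdges (H.reachableSet v) := by
  intro e he
  by_cases h : ∃ x ∈ e, x ∈ H.reachableSet v
  · obtain ⟨x, hx, hv⟩ := h
    exact Or.inl (subset_reachableSet he hx hv)
  · exact Or.inr fun x hx hv => h ⟨x, hx, hv⟩

theorem IsClosedUnderEdges.union {H : Hypergraph α} {A B : Set α} (hA : H.IsClosedUnderEdges A)
    (hB : H.IsClosedUnderEdges B) : H.IsClosedUnderEdges (A ∪ B) := by
  intro e he
  rcases hA e he with h | h
  · exact Or.inl (h.trans Set.subset_union_left)
  rcases hB e he with h' | h'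
  · exact Or.inl (h'.trans Set.subset_union_right)
  · exact Or.inr fun x hx hx' => hx'.elim (h hx) (h' hx)

theorem IsClosedUnderEdges.diff {H : Hypergraph α} {A B : Set α} (hA : H.IsClosedUnderEdges A)
    (hB : H.IsClosedUnderEdges B) : H.IsClosedUnderEdges (A \ B) := by
  intro e he
  rcases hA e he with h | h
  · rcases hB e he with h' | h'
    · exact Or.inr fun x hx hx' => hx'.2 (h' hx)
    · exact Or.inl fun x hx => ⟨h hx, h' hx⟩
  · exact Or.inr fun x hx hx' => h hx hx'.1

/-- A path starting at `v` never leaves the reachable set, so its edges satisfy the containment that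
`IsConnectedSet` demands. -/
theorem isComponent_reachableSet (H : Hypergraph α) (hV : V(H) = Set.univ) (v : α) :
    H.IsComponent (H.reachableSet v) := by
  set S := H.reachableSet v with hS
  let r : α → α → Prop := fun x y => ∃ e ∈ E(H), e ⊆ S ∧ x ∈ e ∧ y ∈ e
  have hsymm : Std.Symm r := ⟨fun x y ⟨e, he, hes, hx, hy⟩ => ⟨e, he, hes, hy, hx⟩⟩
  have hreach : ∀ u ∈ S, Relation.ReflTransGen r v u := by
    intro u hu
    induction hu with
    | refl => exact Relation.ReflTransGen.refl
    | @tail x y hx hxy ih =>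
      obtain ⟨e, he, hxe, hye⟩ := hxy
      exact ih.tail ⟨e, he, subset_reachableSet he hxe hx, hxe, hye⟩
  have hconn : H.IsConnectedSet S := by
    refine ⟨by simp [hV], ⟨v, H.mem_reachableSet_self v⟩, fun u hu u' hu' => ?_⟩
    exact (Relation.ReflTransGen.stdSymm.symm _ _ (hreach u hu)).trans (hreach u' hu')
  refine ⟨hconn, fun T hT hST u hu => ?_⟩
  have huv := hT.2.2 v (hST (H.mem_reachableSet_self v)) u hu
  exact huv.lift id fun x y ⟨e, he, _, hx, hy⟩ => ⟨e, he, hx, hy⟩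

/-- If `2 / 3 ≤ β`, then either some component has weight at least `β`, or some union of
components has weight between `1 - β` and `β`. -/
theorem exists_reachableSet_or_isClosedUnderEdges [Finite α] {ι : Type*} [Fintype ι] [Nonempty ι]
    (H : Hypergraph α) (w : ι → α) {β : ℝ} (hβ : 2 / 3 ≤ β) :
    (∃ v, β ≤ weight w (H.reachableSet v)) ∨
      ∃ B, H.IsClosedUnderEdges B ∧ 1 - β ≤ weight w B ∧ weight w B ≤ β := by
  obtain ⟨A, ⟨hA, hAβ⟩, hmax⟩ := Set.exists_max_image
    {A : Set α | H.IsClosedUnderEdges A ∧ weight w A ≤ β} (weight w) (Set.toFinite _)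
    ⟨∅, fun e _ => Or.inr (by simp), by rw [weight_empty]; linarith⟩
  by_cases hA1 : 1 - β ≤ weight w A
  · exact Or.inr ⟨A, hA, hA1, hAβ⟩
  push Not at hA1
  have hpos : 0 < weight w Aᶜ := by rw [weight_compl]; linarith
  obtain ⟨x, hx⟩ := exists_mem_of_weight_pos w hpos
  have hS := H.isClosedUnderEdges_reachableSet (w x)
  set S := H.reachableSet (w x) with hSdef
  by_cases hSβ : β ≤ weight w S
  · exact Or.inl ⟨w x, hSβ⟩
  push Not at hSβ
  -- By maximality `A ∪ S` is heavier than `β` although `A` is lighter than `1 - β`, so `S` weighs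
  -- more than `2 * β - 1`, which is at least `1 - β` since `2 / 3 ≤ β`.
  refine Or.inr ⟨S, hS, ?_, hSβ.le⟩
  have hdiff := weight_union_of_disjoint w (disjoint_sdiff_self_right (x := A) (y := S))
  have hdpos : 0 < weight w (S \ A) :=
    weight_pos_of_mem w (x := x) ⟨H.mem_reachableSet_self _, hx⟩
  have hbig : β < weight w (A ∪ S \ A) := by
    by_contra hle
    have := hmax (A ∪ S \ A) ⟨hA.union (hS.diff hA), not_lt.1 hle⟩
    linarith
  have hsub : weight w (S \ A) ≤ weight w S := by
    have := weight_union_of_disjoint w (disjoint_sdiff_self_right (x := S ∩ A) (y := S))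
    rw [Set.union_sdiff_cancel Set.inter_subset_left, Set.sdiff_self_inter] at this
    have := weight_nonneg w (S ∩ A)
    linarith
  linarith

end Hypergraph

/-! ### The threshold `2 ^ (-1 / r)` and convexity -/

theorem two_rpow_neg_one_div_pow {r : ℕ} (hr : r ≠ 0) : ((2 : ℝ) ^ (-1 / (r : ℝ))) ^ r = 1 / 2 := by
  rw [← Real.rpow_natCast, ← Real.rpow_mul (by norm_num), div_mul_cancel₀ _ (by exact_mod_cast hr),
    Real.rpow_neg_one]
  norm_num

theorem two_thirds_le_two_rpow {r : ℕ} (hr : 2 ≤ r) : 2 / 3 ≤ (2 : ℝ) ^ (-1 / (r : ℝ)) := by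
  by_contra! h
  have h1 : ((2 : ℝ) ^ (-1 / (r : ℝ))) ^ r ≤ (2 / 3) ^ r :=
    pow_le_pow_left₀ (by positivity) h.le r
  have h2 : (2 / 3 : ℝ) ^ r ≤ (2 / 3) ^ 2 := pow_le_pow_of_le_one (by norm_num) (by norm_num) hr
  rw [two_rpow_neg_one_div_pow (by omega)] at h1
  norm_num at h2
  linarith

theorem two_rpow_le_one (r : ℕ) : (2 : ℝ) ^ (-1 / (r : ℝ)) ≤ 1 :=
  Real.rpow_le_one_of_one_le_of_nonpos (by norm_num)
    (div_nonpos_of_nonpos_of_nonneg (by norm_num) (by positivity))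

theorem separatorConst_lt_half {r : ℕ} (hr : 2 ≤ r) : separatorConst r < 1 / 2 := by
  have h1 := two_thirds_le_two_rpow hr
  have h2 := two_rpow_le_one r
  have : separatorConst r ≤ (1 - (2 : ℝ) ^ (-1 / (r : ℝ))) ^ 1 :=
    pow_le_pow_of_le_one (by linarith) (by linarith) (by omega)
  linarith

/-- On `[1 - β, β]` the function `t ^ r + (1 - t) ^ r` is at most its value at the endpoints. -/
theorem pow_add_one_sub_pow_le {β t : ℝ} (r : ℕ) (h1 : β ≤ 1) (ht1 : 1 - β ≤ t) (ht2 : t ≤ β) :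
    t ^ r + (1 - t) ^ r ≤ β ^ r + (1 - β) ^ r := by
  rcases eq_or_lt_of_le (ht1.trans ht2) with h | h
  · have : t = β := by linarith
    rw [this]
  have hd : 0 < 2 * β - 1 := by linarith
  have hd' : 2 * β - 1 ≠ 0 := hd.ne'
  set a := (t - (1 - β)) / (2 * β - 1) with ha
  set b := (β - t) / (2 * β - 1) with hb
  have hab : a + b = 1 := by
    rw [ha, hb, ← add_div, div_eq_one_iff_eq hd']; ring
  have ha0 : 0 ≤ a := div_nonneg (by linarith) hd.le
  have hb0 : 0 ≤ b := div_nonneg (by linarith) hd.le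
  have hβ0 : β ∈ Set.Ici (0 : ℝ) := by simp only [Set.mem_Ici]; linarith
  have hβ1 : 1 - β ∈ Set.Ici (0 : ℝ) := by simp only [Set.mem_Ici]; linarith
  have e1 : a * β + b * (1 - β) = t := by
    rw [ha, hb, div_mul_eq_mul_div, div_mul_eq_mul_div, ← add_div, div_eq_iff hd']; ring
  have e2 : b * β + a * (1 - β) = 1 - t := by linear_combination hab - e1
  have c1 := (convexOn_pow r).2 hβ0 hβ1 ha0 hb0 hab
  have c2 := (convexOn_pow r).2 hβ0 hβ1 hb0 ha0 (by linarith)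
  simp only [smul_eq_mul] at c1 c2
  rw [e1] at c1
  rw [e2] at c2
  calc _ ≤ (a * β ^ r + b * (1 - β) ^ r) + (b * β ^ r + a * (1 - β) ^ r) := add_le_add c1 c2
    _ = (a + b) * (β ^ r + (1 - β) ^ r) := by ring
    _ = _ := by rw [hab, one_mul]

/-! ### The deterministic separator bound -/

namespace Hypergraph

/-- If every vertex set `S` of weight `x` spans at most `(x ^ r + δ) m` of the `m` hyperedges, then
every balanced separator has at least `(1 / 2 - ε_r) m - 2 δ m` hyperedges. -/
theorem IsBalancedSeparator.le_ncard {α ι : Type*} [Finite α] [Fintype ι] [Nonempty ι] {r : ℕ}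
    (hr : 2 ≤ r) {H : Hypergraph α} (hV : V(H) = Set.univ)
    (w : ι → α) {δ : ℝ} (hδ : 0 ≤ δ)
    (hind : ∀ S : Set α, ({e ∈ E(H) | e ⊆ S}.ncard : ℝ) ≤ (weight w S ^ r + δ) * E(H).ncard)
    {R : Set (Set α)} (hR : H.IsBalancedSeparator R) :
    (1 / 2 - separatorConst r) * E(H).ncard - 2 * δ * E(H).ncard ≤ R.ncard := by
  set m : ℝ := (E(H).ncard : ℝ) with hm
  have hm0 : 0 ≤ m := by positivity
  set β : ℝ := (2 : ℝ) ^ (-1 / (r : ℝ)) with hβ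
  have hβr : β ^ r = 1 / 2 := two_rpow_neg_one_div_pow (by omega)
  have hβ1 : β ≤ 1 := two_rpow_le_one r
  have hε : separatorConst r = (1 - β) ^ r := rfl
  have hcard : ((E(H) \ R).ncard : ℝ) + R.ncard = m := by
    rw [hm]
    exact_mod_cast Set.ncard_sdiff_add_ncard_of_subset hR.1
  suffices h : ((E(H) \ R).ncard : ℝ) ≤ (1 / 2 + separatorConst r + 2 * δ) * m by linarith
  have hVR : V(H.deleteEdges R) = Set.univ := hV
  have hinside : ∀ S : Set α, ({e ∈ E(H) \ R | e ⊆ S}.ncard : ℝ) ≤ (weight w S ^ r + δ) * m := by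
    intro S
    refine le_trans ?_ (hind S)
    have hsub : {e ∈ E(H) \ R | e ⊆ S} ⊆ {e ∈ E(H) | e ⊆ S} := fun e he => ⟨he.1.1, he.2⟩
    exact_mod_cast Set.ncard_le_ncard hsub (Set.toFinite _)
  rcases exists_reachableSet_or_isClosedUnderEdges (H.deleteEdges R) w
    (two_thirds_le_two_rpow hr) with ⟨v, hv⟩ | ⟨B, hB, hB1, hB2⟩
  · set S := (H.deleteEdges R).reachableSet v with hS
    have hcomp := hR.2 S (isComponent_reachableSet _ hVR v)
    have hsub : E(H) \ R ⊆ {e ∈ E(H) \ R | (e ∩ S).Nonempty} ∪ {e ∈ E(H) \ R | e ⊆ Sᶜ} := by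
      intro e he
      by_cases h : (e ∩ S).Nonempty
      · exact Or.inl ⟨he, h⟩
      · exact Or.inr ⟨he, fun x hx hxS => h ⟨x, hx, hxS⟩⟩
    have h1 : ((E(H) \ R).ncard : ℝ) ≤ ({e ∈ E(H) \ R | (e ∩ S).Nonempty}.ncard : ℝ) +
        ({e ∈ E(H) \ R | e ⊆ Sᶜ}.ncard : ℝ) := by
      exact_mod_cast (Set.ncard_le_ncard hsub (Set.toFinite _)).trans (Set.ncard_union_le _ _)
    have h2 := hinside Sᶜ
    have h3 : weight w Sᶜ ^ r ≤ (1 - β) ^ r :=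
      pow_le_pow_left₀ (weight_nonneg w _) (by rw [weight_compl]; linarith) r
    have h4 := mul_le_mul_of_nonneg_right h3 hm0
    rw [hε]
    nlinarith [mul_nonneg hδ hm0]
  · have hsub : E(H) \ R ⊆ {e ∈ E(H) \ R | e ⊆ B} ∪ {e ∈ E(H) \ R | e ⊆ Bᶜ} := fun e he =>
      (hB e he).imp (fun h => ⟨he, h⟩) (fun h => ⟨he, h⟩)
    have h1 : ((E(H) \ R).ncard : ℝ) ≤ ({e ∈ E(H) \ R | e ⊆ B}.ncard : ℝ) +
        ({e ∈ E(H) \ R | e ⊆ Bᶜ}.ncard : ℝ) := by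
      exact_mod_cast (Set.ncard_le_ncard hsub (Set.toFinite _)).trans (Set.ncard_union_le _ _)
    have h2 := hinside B
    have h3 := hinside Bᶜ
    rw [weight_compl] at h3
    have h4 := mul_le_mul_of_nonneg_right (pow_add_one_sub_pow_le r hβ1 hB1 hB2) hm0
    rw [hβr] at h4
    rw [hε]
    linarith

end Hypergraph

/-! ### Collision counts for random tuples -/

section Collision

variable {ι κ : Type*} [Fintype ι] [DecidableEq ι] [Fintype κ] [DecidableEq κ]

/-- Overwriting the value at `s` loses no information, because it can be read off at `t`. -/
theorem card_collision_mul_le {s t : ι} (h : s ≠ t) :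
    (Finset.univ.filter fun ω : ι → κ => ω s = ω t).card * Fintype.card κ ≤
      Fintype.card (ι → κ) := by
  rw [← Finset.card_univ (α := κ), ← Finset.card_product, ← Finset.card_univ (α := ι → κ)]
  refine Finset.card_le_card_of_injOn (fun p => Function.update p.1 s p.2) (by simp) ?_
  rintro ⟨ω, x⟩ h1 ⟨ω', x'⟩ h2 heq
  simp only [Finset.coe_product, Set.mem_prod, Finset.mem_coe, Finset.mem_filter,
    Finset.mem_univ, true_and, and_true] at h1 h2
  have hv := fun i => congrFun heq i
  have hx : x = x' := by simpa using hv s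
  have ho : ∀ i, i ≠ s → ω i = ω' i := fun i hi => by simpa [hi] using hv i
  refine Prod.ext (funext fun i => ?_) hx
  by_cases hi : i = s
  · subst hi
    simp only [h1, h2, ho t h.symm]
  · exact ho i hi

theorem card_double_collision_mul_le {s s' t t' : ι} (h : s ≠ s') (h1 : t ≠ s) (h2 : t ≠ s')
    (h3 : t' ≠ s) (h4 : t' ≠ s') :
    (Finset.univ.filter fun ω : ι → κ => ω s = ω t ∧ ω s' = ω t').card * Fintype.card κ ^ 2 ≤
      Fintype.card (ι → κ) := by
  rw [sq, ← Finset.card_univ (α := κ), ← Finset.card_product, ← Finset.card_product,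
    ← Finset.card_univ (α := ι → κ)]
  refine Finset.card_le_card_of_injOn
    (fun p => Function.update (Function.update p.1 s p.2.1) s' p.2.2) (by simp) ?_
  rintro ⟨ω, x, y⟩ hω ⟨ω', x', y'⟩ hω' heq
  simp only [Finset.coe_product, Set.mem_prod, Finset.mem_coe, Finset.mem_filter,
    Finset.mem_univ, true_and, and_true] at hω hω'
  have hv := fun i => congrFun heq i
  have hy : y = y' := by simpa using hv s'
  have hx : x = x' := by simpa [h] using hv s
  have ho : ∀ i, i ≠ s → i ≠ s' → ω i = ω' i := fun i hi hi' => by simpa [hi, hi'] using hv i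
  refine Prod.ext (funext fun i => ?_) (Prod.ext hx hy)
  by_cases hi : i = s
  · subst hi
    simp only [hω.1, hω'.1, ho t h1 h2]
  by_cases hi' : i = s'
  · subst hi'
    simp only [hω.2, hω'.2, ho t' h3 h4]
  · exact ho i hi hi'

theorem sum_collision_le [Nonempty κ] {s t : ι} (h : s ≠ t) :
    ∑ ω : ι → κ, (if ω s = ω t then (1 : ℝ) else 0) ≤
      Fintype.card (ι → κ) / (Fintype.card κ : ℝ) := by
  rw [Finset.sum_boole, le_div_iff₀ (by exact_mod_cast Fintype.card_pos)]
  exact_mod_cast card_collision_mul_le h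

theorem sum_double_collision_le [Nonempty κ] {s s' t t' : ι} (h : s ≠ s') (h1 : t ≠ s)
    (h2 : t ≠ s') (h3 : t' ≠ s) (h4 : t' ≠ s') :
    ∑ ω : ι → κ, (if ω s = ω t ∧ ω s' = ω t' then (1 : ℝ) else 0) ≤
      Fintype.card (ι → κ) / (Fintype.card κ : ℝ) ^ 2 := by
  have : (0 : ℝ) < Fintype.card κ := by exact_mod_cast Fintype.card_pos
  rw [Finset.sum_boole, le_div_iff₀ (by positivity)]
  exact_mod_cast card_double_collision_mul_le h h1 h2 h3 h4

end Collision

/-! ### Bad tuples -/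

/-- In a family `ω` of `r`-tuples of vertices, the tuple `j` is bad if it has a repeated entry, if
its entries all lie in another tuple, or if one of its entries lies in `k` other tuples. -/
def IsBadTuple {m r n : ℕ} (k : ℕ) (ω : Fin m × Fin r → Fin n) (j : Fin m) : Prop :=
  (∃ a b, a ≠ b ∧ ω (j, a) = ω (j, b)) ∨
  (∃ j', j' ≠ j ∧ ∀ a, ∃ b, ω (j, a) = ω (j', b)) ∨
  ∃ a, k ≤ (Finset.univ.filter fun j' => j' ≠ j ∧ ∃ b, ω (j, a) = ω (j', b)).card

-- Containment in another tuple is relaxed to a collision of the two entries `a₀` and `a₁` with it.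
-- Two entries are needed: summed over `m` tuples, a single collision has expectation of order `m /
-- n`, which is not small, while two give `m / n ^ 2`. The last term is Markov's inequality for the
-- number of collisions.
open Classical in
theorem ite_isBadTuple_le {m r n k : ℕ} (hk : 0 < k) (ω : Fin m × Fin r → Fin n) (j : Fin m)
    (a₀ a₁ : Fin r) :
    (if IsBadTuple k ω j then (1 : ℝ) else 0) ≤
      (∑ a, ∑ b, if a ≠ b then (if ω (j, a) = ω (j, b) then (1 : ℝ) else 0) else 0) +
      (∑ j', ∑ b, ∑ b', if j' ≠ j then
        (if ω (j, a₀) = ω (j', b) ∧ ω (j, a₁) = ω (j', b') then (1 : ℝ) else 0) else 0) +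
      (∑ a, ∑ j', ∑ b, if j' ≠ j then (if ω (j, a) = ω (j', b) then (1 : ℝ) else 0) else 0) / k := by
  have n1 : 0 ≤ ∑ a, ∑ b, if a ≠ b then (if ω (j, a) = ω (j, b) then (1 : ℝ) else 0) else 0 :=
    Finset.sum_nonneg fun a _ => Finset.sum_nonneg fun b _ => by split_ifs <;> norm_num
  have n2 : 0 ≤ ∑ j', ∑ b, ∑ b', if j' ≠ j then
        (if ω (j, a₀) = ω (j', b) ∧ ω (j, a₁) = ω (j', b') then (1 : ℝ) else 0) else 0 :=
    Finset.sum_nonneg fun a _ => Finset.sum_nonneg fun b _ => Finset.sum_nonneg fun b' _ => by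
      split_ifs <;> norm_num
  have n3 : 0 ≤ (∑ a, ∑ j', ∑ b,
      if j' ≠ j then (if ω (j, a) = ω (j', b) then (1 : ℝ) else 0) else 0) / k :=
    div_nonneg (Finset.sum_nonneg fun a _ => Finset.sum_nonneg fun b _ => Finset.sum_nonneg
      fun b' _ => by split_ifs <;> norm_num) (by positivity)
  by_cases hbad : IsBadTuple k ω j
  swap
  · rw [if_neg hbad]; positivity
  rw [if_pos hbad]
  rcases hbad with ⟨a, b, hab, h⟩ | ⟨j', hj, h⟩ | ⟨a, h⟩
  · have : (1 : ℝ) ≤ ∑ a, ∑ b, if a ≠ b then (if ω (j, a) = ω (j, b) then (1 : ℝ) else 0) else 0 := by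
      refine le_trans ?_ (Finset.single_le_sum (fun a _ => Finset.sum_nonneg fun b _ => ?_)
        (Finset.mem_univ a))
      · refine le_trans ?_ (Finset.single_le_sum (fun b _ => ?_) (Finset.mem_univ b))
        · rw [if_pos hab, if_pos h]
        · split_ifs <;> norm_num
      · split_ifs <;> norm_num
    linarith
  · obtain ⟨b, hb⟩ := h a₀
    obtain ⟨b', hb'⟩ := h a₁
    have : (1 : ℝ) ≤ ∑ j', ∑ b, ∑ b', if j' ≠ j then
        (if ω (j, a₀) = ω (j', b) ∧ ω (j, a₁) = ω (j', b') then (1 : ℝ) else 0) else 0 := by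
      refine le_trans ?_ (Finset.single_le_sum (fun a _ => Finset.sum_nonneg fun b _ =>
        Finset.sum_nonneg fun b' _ => ?_) (Finset.mem_univ j'))
      · refine le_trans ?_ (Finset.single_le_sum (fun b _ => Finset.sum_nonneg fun b' _ => ?_)
          (Finset.mem_univ b))
        · refine le_trans ?_ (Finset.single_le_sum (fun b _ => ?_) (Finset.mem_univ b'))
          · rw [if_pos hj, if_pos ⟨hb, hb'⟩]
          · split_ifs <;> norm_num
        · split_ifs <;> norm_num
      · split_ifs <;> norm_num
    linarith
  · have hcard : (k : ℝ) ≤ ∑ a, ∑ j', ∑ b,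
        if j' ≠ j then (if ω (j, a) = ω (j', b) then (1 : ℝ) else 0) else 0 := by
      refine le_trans ?_ (Finset.single_le_sum (fun a _ => Finset.sum_nonneg fun b _ =>
        Finset.sum_nonneg fun b' _ => ?_) (Finset.mem_univ a))
      · have h' : (k : ℝ) ≤ ∑ j', if j' ≠ j ∧ ∃ b, ω (j, a) = ω (j', b) then (1 : ℝ) else 0 := by
          rw [Finset.sum_boole]; convert! (Nat.cast_le (α := ℝ)).2 h
        refine h'.trans (Finset.sum_le_sum fun j' _ => ?_)
        split_ifs with hc hj hj
        · obtain ⟨b, hb⟩ := hc.2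
          refine le_trans ?_ (Finset.single_le_sum (fun b _ => ?_) (Finset.mem_univ b))
          · rw [if_pos hb]
          · split_ifs <;> norm_num
        · exact absurd hc.1 hj
        · exact Finset.sum_nonneg fun b _ => by split_ifs <;> norm_num
        · simp
      · split_ifs <;> norm_num
    have : (1 : ℝ) ≤ (∑ a, ∑ j', ∑ b,
        if j' ≠ j then (if ω (j, a) = ω (j', b) then (1 : ℝ) else 0) else 0) / k := by
      rwa [le_div_iff₀ (by exact_mod_cast hk), one_mul]
    linarith

open Classical in
theorem sum_ite_isBadTuple_le {m r n k : ℕ} (hr : 2 ≤ r) (hn : 0 < n) (hk : 0 < k) (j : Fin m) :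
    ∑ ω : Fin m × Fin r → Fin n, (if IsBadTuple k ω j then (1 : ℝ) else 0) ≤
      Fintype.card (Fin m × Fin r → Fin n) *
        ((r : ℝ) ^ 2 / n + m * (r : ℝ) ^ 2 / (n : ℝ) ^ 2 + m * (r : ℝ) ^ 2 / (n * k)) := by
  have : Nonempty (Fin n) := ⟨⟨0, hn⟩⟩
  set N : ℝ := ((Fintype.card (Fin m × Fin r → Fin n) : ℕ) : ℝ) with hN
  have hN0 : 0 ≤ N := by positivity
  let a₀ : Fin r := ⟨0, by omega⟩
  let a₁ : Fin r := ⟨1, by omega⟩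
  have ha : a₀ ≠ a₁ := by simp [a₀, a₁]
  refine (Finset.sum_le_sum fun ω _ => ite_isBadTuple_le hk ω j a₀ a₁).trans ?_
  rw [Finset.sum_add_distrib, Finset.sum_add_distrib, ← Finset.sum_div]
  have e1 : ∑ ω : Fin m × Fin r → Fin n, ∑ a, ∑ b,
      (if a ≠ b then (if ω (j, a) = ω (j, b) then (1 : ℝ) else 0) else 0) ≤
      ∑ _a : Fin r, ∑ _b : Fin r, N / n := by
    rw [Finset.sum_comm]
    refine Finset.sum_le_sum fun a _ => ?_
    rw [Finset.sum_comm]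
    refine Finset.sum_le_sum fun b _ => ?_
    split_ifs with h
    · have := sum_collision_le (κ := Fin n) (s := (j, a)) (t := (j, b)) (by simp [h])
      simpa [hN] using this
    · simp only [Finset.sum_const_zero]; positivity
  have e2 : ∑ ω : Fin m × Fin r → Fin n, ∑ j', ∑ b, ∑ b', (if j' ≠ j then
      (if ω (j, a₀) = ω (j', b) ∧ ω (j, a₁) = ω (j', b') then (1 : ℝ) else 0) else 0) ≤
      ∑ _j : Fin m, ∑ _b : Fin r, ∑ _b' : Fin r, N / (n : ℝ) ^ 2 := by
    rw [Finset.sum_comm]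
    refine Finset.sum_le_sum fun j' _ => ?_
    rw [Finset.sum_comm]
    refine Finset.sum_le_sum fun b _ => ?_
    rw [Finset.sum_comm]
    refine Finset.sum_le_sum fun b' _ => ?_
    split_ifs with h
    · have := sum_double_collision_le (κ := Fin n) (s := (j, a₀)) (s' := (j, a₁)) (t := (j', b))
        (t' := (j', b')) (by simp [ha]) (by simp [h]) (by simp [h]) (by simp [h]) (by simp [h])
      simpa [hN] using this
    · simp only [Finset.sum_const_zero]; positivity
  have e3 : ∑ ω : Fin m × Fin r → Fin n, ∑ a, ∑ j', ∑ b,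
      (if j' ≠ j then (if ω (j, a) = ω (j', b) then (1 : ℝ) else 0) else 0) ≤
      ∑ _a : Fin r, ∑ _j : Fin m, ∑ _b : Fin r, N / n := by
    rw [Finset.sum_comm]
    refine Finset.sum_le_sum fun a _ => ?_
    rw [Finset.sum_comm]
    refine Finset.sum_le_sum fun j' _ => ?_
    rw [Finset.sum_comm]
    refine Finset.sum_le_sum fun b _ => ?_
    split_ifs with h
    · have := sum_collision_le (κ := Fin n) (s := (j, a)) (t := (j', b)) (by simp [Ne.symm h])
      simpa [hN] using this
    · simp only [Finset.sum_const_zero]; positivity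
  have e3' := div_le_div_of_nonneg_right e3 (Nat.cast_nonneg (α := ℝ) k)
  refine (add_le_add (add_le_add e1 e2) e3').trans (le_of_eq ?_)
  simp only [Finset.sum_const, Finset.card_univ, Fintype.card_fin, nsmul_eq_mul]
  have : (n : ℝ) ≠ 0 := by positivity
  have : (k : ℝ) ≠ 0 := by positivity
  field_simp

/-! ### Concentration and the choice of an outcome -/

/-- The number of tuples of the family `ω` all of whose entries lie in `S`. -/
def tuplesIn {m r n : ℕ} (ω : Fin m × Fin r → Fin n) (S : Finset (Fin n)) : ℕ :=
  (Finset.univ.filter fun j => ∀ a, ω (j, a) ∈ S).card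

/-- The exponential factors over the independent tuples, and `exp l - 1 ≤ l + l ^ 2` bounds each
factor. -/
theorem sum_exp_tuplesIn_le {m r n : ℕ} (hn : 0 < n) (S : Finset (Fin n)) {l : ℝ} (hl0 : 0 ≤ l)
    (hl1 : l ≤ 1) :
    ∑ ω : Fin m × Fin r → Fin n, Real.exp (l * tuplesIn ω S) ≤
      Fintype.card (Fin m × Fin r → Fin n) *
        Real.exp ((l * ((S.card : ℝ) / n) ^ r + l ^ 2) * m) := by
  let g : (Fin r → Fin n) → ℝ := fun t => if ∀ a, t a ∈ S then Real.exp l else 1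
  set p : ℝ := ((S.card : ℝ) / n) ^ r with hp
  have hn' : (n : ℝ) ≠ 0 := by positivity
  have hp1 : p ≤ 1 := by
    refine pow_le_one₀ (by positivity) (div_le_one_of_le₀ ?_ (by positivity))
    exact_mod_cast (Finset.card_le_univ S).trans (by simp)
  have hp0 : 0 ≤ p := by positivity
  have hexp : ∀ ω : Fin m × Fin r → Fin n,
      Real.exp (l * tuplesIn ω S) = ∏ j, g (fun a => ω (j, a)) := by
    intro ω
    simp only [g, tuplesIn]
    rw [Finset.prod_ite, Finset.prod_const, Finset.prod_const_one, mul_one, ← Real.exp_nat_mul,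
      mul_comm]
  have hsum : ∑ ω : Fin m × Fin r → Fin n, Real.exp (l * tuplesIn ω S) = (∑ t, g t) ^ m := by
    rw [Fintype.sum_pow]
    exact Fintype.sum_equiv (Equiv.curry _ _ _) _ _ fun ω => hexp ω
  have hcard : (Finset.univ.filter fun t : Fin r → Fin n => ∀ a, t a ∈ S).card = S.card ^ r := by
    have : (Finset.univ.filter fun t : Fin r → Fin n => ∀ a, t a ∈ S) =
        Fintype.piFinset fun _ => S := by ext t; simp
    rw [this]; simp
  have hg : ∑ t, g t ≤ (n : ℝ) ^ r * Real.exp (l * p + l ^ 2) := by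
    have h1 : ∀ t, g t = 1 + (if ∀ a, t a ∈ S then Real.exp l - 1 else 0) := by
      intro t; simp only [g]; split_ifs <;> ring
    have h2 : ∑ t, g t = (n : ℝ) ^ r + (S.card : ℝ) ^ r * (Real.exp l - 1) := by
      simp_rw [h1]
      rw [Finset.sum_add_distrib, ← Finset.sum_filter, Finset.sum_const, Finset.sum_const, hcard]
      simp
    have h3 : (S.card : ℝ) ^ r = (n : ℝ) ^ r * p := by
      rw [hp, div_pow]; field_simp
    have h4 : Real.exp l - 1 ≤ l + l ^ 2 := by
      have := (abs_le.1 (Real.abs_exp_sub_one_sub_id_le (x := l) (by rwa [abs_of_nonneg hl0]))).2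
      linarith
    have h5 : p * (Real.exp l - 1) ≤ l * p + l ^ 2 := by
      have := mul_le_mul_of_nonneg_left h4 hp0
      nlinarith [sq_nonneg l, mul_le_mul_of_nonneg_right hp1 (sq_nonneg l)]
    rw [h2, h3]
    calc (n : ℝ) ^ r + (n : ℝ) ^ r * p * (Real.exp l - 1)
        = (n : ℝ) ^ r * (p * (Real.exp l - 1) + 1) := by ring
      _ ≤ (n : ℝ) ^ r * Real.exp (l * p + l ^ 2) := by
        gcongr
        exact (by linarith : p * (Real.exp l - 1) + 1 ≤ (l * p + l ^ 2) + 1).trans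
          (Real.add_one_le_exp _)
  have hg0 : 0 ≤ ∑ t, g t := Finset.sum_nonneg fun t _ => by
    simp only [g]; split_ifs <;> positivity
  rw [hsum]
  refine (pow_le_pow_left₀ hg0 hg m).trans (le_of_eq ?_)
  rw [mul_pow, ← Real.exp_nat_mul]
  simp only [Fintype.card_pi, Finset.prod_const, Finset.card_univ, Fintype.card_prod,
    Fintype.card_fin]
  push_cast
  rw [← pow_mul, mul_comm r m, mul_comm (m : ℝ)]

open Classical in
theorem exists_tuples {m r n k : ℕ} (hr : 2 ≤ r) (hn : 0 < n) (hk : 0 < k) (hm : 0 < m) {δ : ℝ}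
    (hδ0 : 0 < δ) (hδ1 : δ ≤ 1)
    (hbad : (r : ℝ) ^ 2 / n + m * (r : ℝ) ^ 2 / (n : ℝ) ^ 2 + m * (r : ℝ) ^ 2 / (n * k) ≤ δ / 2)
    (hexp : (2 : ℝ) ^ n * Real.exp (-(δ ^ 2 * m / 4)) < 1 / 2) :
    ∃ ω : Fin m × Fin r → Fin n,
      ((Finset.univ.filter fun j => IsBadTuple k ω j).card : ℝ) ≤ δ * m ∧
      ∀ S : Finset (Fin n), (tuplesIn ω S : ℝ) ≤ (((S.card : ℝ) / n) ^ r + δ) * m := by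
  have : Nonempty (Fin n) := ⟨⟨0, hn⟩⟩
  set N : ℝ := ((Fintype.card (Fin m × Fin r → Fin n) : ℕ) : ℝ) with hN
  have hN0 : 0 < N := by rw [hN]; exact_mod_cast Fintype.card_pos
  have hm' : (0 : ℝ) < m := by exact_mod_cast hm
  set l : ℝ := δ / 2 with hl
  let p : Finset (Fin n) → ℝ := fun S => ((S.card : ℝ) / n) ^ r
  let b : (Fin m × Fin r → Fin n) → ℝ := fun ω => (Finset.univ.filter fun j => IsBadTuple k ω j).card
  -- Both requirements hold wherever `f < 1`, and each summand has mean at most `1 / 2`, the second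
  -- strictly less. With `l = δ / 2` the exponent `l ^ 2 - l * δ` equals `-δ ^ 2 / 4`.
  let f : (Fin m × Fin r → Fin n) → ℝ := fun ω =>
    b ω / (δ * m) + ∑ S : Finset (Fin n), Real.exp (l * tuplesIn ω S - l * ((p S + δ) * m))
  have hb : ∑ ω, b ω ≤ N * (m * (δ / 2)) := by
    have : ∀ ω, b ω = ∑ j, if IsBadTuple k ω j then (1 : ℝ) else 0 := by
      intro ω; rw [Finset.sum_boole]
    simp_rw [this]
    rw [Finset.sum_comm]
    calc _ ≤ ∑ _j : Fin m, N * (δ / 2) := Finset.sum_le_sum fun j _ =>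
          (sum_ite_isBadTuple_le hr hn hk j).trans (by gcongr)
      _ = _ := by simp; ring
  have hS : ∀ S : Finset (Fin n),
      ∑ ω : Fin m × Fin r → Fin n, Real.exp (l * tuplesIn ω S - l * ((p S + δ) * m)) ≤
        N * Real.exp (-(δ ^ 2 * m / 4)) := by
    intro S
    simp_rw [Real.exp_sub]
    rw [← Finset.sum_div, div_le_iff₀ (Real.exp_pos _), mul_assoc, ← Real.exp_add]
    refine (sum_exp_tuplesIn_le hn S (by positivity) (by linarith)).trans (le_of_eq ?_)
    congr 2
    simp only [p, hl]; ring
  have hsum : ∑ ω, f ω < ∑ _ω : Fin m × Fin r → Fin n, (1 : ℝ) := by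
    simp only [f]
    rw [Finset.sum_add_distrib, ← Finset.sum_div, Finset.sum_comm]
    have h1 : (∑ ω, b ω) / (δ * m) ≤ N / 2 := by
      rw [div_le_iff₀ (by positivity)]; linarith
    have h2 := Finset.sum_le_sum fun (S : Finset (Fin n)) (_ : S ∈ Finset.univ) => hS S
    rw [Finset.sum_const, Finset.card_univ, Fintype.card_finset, Fintype.card_fin,
      nsmul_eq_mul] at h2
    push_cast at h2
    have h3 := mul_lt_mul_of_pos_left hexp hN0
    simp only [Finset.sum_const, Finset.card_univ, nsmul_eq_mul, mul_one]
    rw [← hN]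
    linarith
  obtain ⟨ω, -, hω⟩ := Finset.exists_lt_of_sum_lt hsum
  have hnn : 0 ≤ b ω / (δ * m) := by positivity
  refine ⟨ω, ?_, fun S => ?_⟩
  · have : 0 ≤ ∑ S : Finset (Fin n), Real.exp (l * tuplesIn ω S - l * ((p S + δ) * m)) :=
      Finset.sum_nonneg fun S _ => (Real.exp_pos _).le
    have h1 : b ω / (δ * m) < 1 := by simp only [f] at hω; linarith
    rw [div_lt_one (by positivity)] at h1
    exact h1.le
  · have h1 : Real.exp (l * tuplesIn ω S - l * ((p S + δ) * m)) < 1 := by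
      have := Finset.single_le_sum (f := fun S : Finset (Fin n) =>
        Real.exp (l * tuplesIn ω S - l * ((p S + δ) * m))) (fun S _ => (Real.exp_pos _).le)
        (Finset.mem_univ S)
      simp only [f] at hω; linarith
    rw [Real.exp_lt_one_iff, ← mul_sub] at h1
    have h2 : 0 < l := by positivity
    have : (tuplesIn ω S : ℝ) - (p S + δ) * m < 0 := by
      by_contra h; push Not at h
      nlinarith [mul_nonneg h2.le h]
    linarith

/-! ### From tuples to hypergraphs -/

namespace Hypergraph

/-- The hypergraph whose hyperedges are the ranges of the tuples of a family. -/
def ofTuples {ι κ α : Type*} (G : ι → κ → α) : Hypergraph α where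
  vertexSet := Set.univ
  edgeSet := Set.range fun j => Set.range (G j)
  subset_vertexSet_of_mem_edgeSet' := fun _ _ => Set.subset_univ _

theorem ncard_edgeSet_ofTuples_sep_le {ι κ α : Type*} [Finite ι] (G : ι → κ → α)
    (p : Set α → Prop) :
    {e ∈ E(ofTuples G) | p e}.ncard ≤ {j | p (Set.range (G j))}.ncard := by
  have : {e ∈ E(ofTuples G) | p e} = (fun j => Set.range (G j)) '' {j | p (Set.range (G j))} := by
    ext e
    constructor
    · rintro ⟨⟨j, rfl⟩, hp⟩
      exact ⟨j, hp, rfl⟩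
    · rintro ⟨j, hp, rfl⟩
      exact ⟨⟨j, rfl⟩, hp⟩
  rw [this]
  exact Set.ncard_image_le (Set.toFinite _)

end Hypergraph

section Repair

variable {m r n : ℕ} (k : ℕ) (ω : Fin m × Fin r → Fin n)

open Classical in
/-- The tuples of `ω`, where each bad tuple is replaced by a tuple of fresh vertices. -/
noncomputable def repairedTuple (j : Fin m) (a : Fin r) : Fin n ⊕ Fin m × Fin r :=
  if IsBadTuple k ω j then Sum.inr (j, a) else Sum.inl (ω (j, a))

theorem repairedTuple_injective (j : Fin m) : Function.Injective (repairedTuple k ω j) := by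
  intro a b hab
  unfold repairedTuple at hab
  split_ifs at hab with h
  · simpa using hab
  · by_contra hne
    exact h (Or.inl ⟨a, b, hne, by simpa using hab⟩)

theorem range_repairedTuple_injective (hr : 0 < r) :
    Function.Injective fun j => Set.range (repairedTuple k ω j) := by
  intro i j hij
  have hsub : ∀ a, ∃ b, repairedTuple k ω j b = repairedTuple k ω i a := fun a => by
    have : repairedTuple k ω i a ∈ Set.range (repairedTuple k ω i) := ⟨a, rfl⟩
    simp only at hij
    rwa [hij] at this
  unfold repairedTuple at hsub
  by_cases hi : IsBadTuple k ω i <;> by_cases hj : IsBadTuple k ω j <;>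
    simp only [hi, hj, if_true, if_false] at hsub
  · obtain ⟨b, hb⟩ := hsub ⟨0, hr⟩
    simp only [Sum.inr.injEq, Prod.mk.injEq] at hb
    exact hb.1.symm
  · obtain ⟨b, hb⟩ := hsub ⟨0, hr⟩
    simp at hb
  · obtain ⟨b, hb⟩ := hsub ⟨0, hr⟩
    simp at hb
  · by_contra hne
    refine hi (Or.inr (Or.inl ⟨j, fun h => hne h.symm, fun a => ?_⟩))
    obtain ⟨b, hb⟩ := hsub a
    exact ⟨b, by simpa using hb.symm⟩

theorem ncard_mem_range_repairedTuple_le (hk : 0 < k) (u : Fin n ⊕ Fin m × Fin r) :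
    {j | u ∈ Set.range (repairedTuple k ω j)}.ncard ≤ k := by
  classical
  rcases u with x | ⟨i, a⟩
  · rcases Set.eq_empty_or_nonempty {j | Sum.inl x ∈ Set.range (repairedTuple k ω j)} with h | h
    · rw [h, Set.ncard_empty]
      exact hk.le
    have key : ∀ j, Sum.inl x ∈ Set.range (repairedTuple k ω j) →
        ¬ IsBadTuple k ω j ∧ ∃ a, ω (j, a) = x := by
      rintro j ⟨a, ha⟩
      unfold repairedTuple at ha
      split_ifs at ha with hb
      exact ⟨hb, a, by simpa using ha⟩
    obtain ⟨j₀, hj₀⟩ := h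
    obtain ⟨hgood, a₀, rfl⟩ := key j₀ hj₀
    -- A good tuple through the vertex shares it with fewer than `k` others; the strict inequality
    -- leaves room for `j₀` itself.
    have hlt : (Finset.univ.filter fun j' => j' ≠ j₀ ∧ ∃ b, ω (j₀, a₀) = ω (j', b)).card < k := by
      by_contra hge
      exact hgood (Or.inr (Or.inr ⟨a₀, not_lt.1 hge⟩))
    have hsub : {j | Sum.inl (ω (j₀, a₀)) ∈ Set.range (repairedTuple k ω j)} ⊆
        ((insert j₀ (Finset.univ.filter fun j' => j' ≠ j₀ ∧ ∃ b, ω (j₀, a₀) = ω (j', b)) :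
          Finset (Fin m)) : Set (Fin m)) := by
      intro j hj
      by_cases hjj : j = j₀
      · simp [hjj]
      · obtain ⟨-, b, hb⟩ := key j hj
        simp only [Finset.coe_insert, Finset.coe_filter, Finset.mem_univ, true_and]
        exact Or.inr ⟨hjj, b, hb.symm⟩
    refine (Set.ncard_le_ncard hsub (Set.toFinite _)).trans ?_
    rw [Set.ncard_coe_finset]
    exact (Finset.card_insert_le _ _).trans hlt
  · have hsub : {j | Sum.inr (i, a) ∈ Set.range (repairedTuple k ω j)} ⊆ {i} := by
      rintro j ⟨b, hb⟩
      unfold repairedTuple at hb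
      split_ifs at hb
      simp only [Sum.inr.injEq, Prod.mk.injEq] at hb
      exact hb.1
    refine (Set.ncard_le_ncard hsub (Set.toFinite _)).trans ?_
    rw [Set.ncard_singleton]
    exact hk

open Classical in
/-- The repaired family gives an `r`-uniform hypergraph with `m` hyperedges and maximum degree at
most `k`, in which the number of hyperedges spanned by a set is controlled by `tuplesIn`. -/
theorem exists_hypergraph_of_tuples (hr : 0 < r) (hk : 0 < k) :
    ∃ (N : ℕ) (H : Hypergraph (Fin N)) (w : Fin n → Fin N), V(H) = Set.univ ∧ H.IsUniform r ∧
      E(H).ncard = m ∧ H.maxDegree ≤ k ∧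
      ∀ S : Set (Fin N), {e ∈ E(H) | e ⊆ S}.ncard ≤
        tuplesIn ω (Finset.univ.filter fun x => w x ∈ S) +
          (Finset.univ.filter fun j => IsBadTuple k ω j).card := by
  let e := Fintype.equivFin (Fin n ⊕ Fin m × Fin r)
  let G : Fin m → Fin r → Fin (Fintype.card (Fin n ⊕ Fin m × Fin r)) :=
    fun j a => e (repairedTuple k ω j a)
  have hG : ∀ j, Set.range (G j) = e '' Set.range (repairedTuple k ω j) := fun j =>
    Set.range_comp e (repairedTuple k ω j)
  have hinj : Function.Injective fun j => Set.range (G j) := by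
    intro i j hij
    simp only [hG] at hij
    exact range_repairedTuple_injective k ω hr (e.injective.image_injective hij)
  refine ⟨_, Hypergraph.ofTuples G, fun x => e (Sum.inl x), rfl, ?_, ?_, ?_, fun S => ?_⟩
  · rintro _ ⟨j, rfl⟩
    have hj : Function.Injective (G j) := e.injective.comp (repairedTuple_injective k ω j)
    change (Set.range (G j)).ncard = r
    rw [← Set.image_univ, Set.ncard_image_of_injective _ hj, Set.ncard_univ]
    simp
  · change (Set.range fun j => Set.range (G j)).ncard = m
    rw [← Set.image_univ, Set.ncard_image_of_injective _ hinj, Set.ncard_univ]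
    simp
  · refine Finset.sup_le fun v _ => ?_
    refine (Hypergraph.ncard_edgeSet_ofTuples_sep_le G fun s => v ∈ s).trans ?_
    refine le_trans (le_of_eq ?_) (ncard_mem_range_repairedTuple_le k ω hk (e.symm v))
    congr 1
    ext j
    simp only [hG, Set.mem_ofPred_eq, Set.mem_image_equiv]
  · refine (Hypergraph.ncard_edgeSet_ofTuples_sep_le G fun s => s ⊆ S).trans ?_
    unfold tuplesIn
    refine le_trans ?_ (Finset.card_union_le _ _)
    rw [← Set.ncard_coe_finset]
    refine Set.ncard_le_ncard (fun j hj => ?_) (Set.toFinite _)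
    simp only [Finset.coe_union, Finset.coe_filter, Finset.mem_univ, true_and, Set.mem_union,
      Set.mem_ofPred_eq]
    by_cases hb : IsBadTuple k ω j
    · exact Or.inr hb
    · refine Or.inl fun a => ?_
      have : G j a ∈ S := hj ⟨a, rfl⟩
      simpa [G, repairedTuple, hb] using this

end Repair

/-! ### Choice of parameters -/

/-- There is an `r`-uniform hypergraph with `m` hyperedges and maximum degree at most `max k 1`, all
of whose balanced separators have at least `(1 / 2 - ε_r) m (1 - δ)` hyperedges. -/
def HasHardHypergraph (r k m : ℕ) (δ : ℝ) : Prop :=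
  ∃ (N : ℕ) (H : Hypergraph (Fin N)), H.IsUniform r ∧ E(H).ncard = m ∧ H.maxDegree ≤ max k 1 ∧
    ∀ R, H.IsBalancedSeparator R →
      (1 / 2 - separatorConst r) * (m : ℝ) * (1 - δ) ≤ (R.ncard : ℝ)

/-- At `δ = 1` the separator bound is void; this is the fallback for small indices. -/
theorem hasHardHypergraph_one {r : ℕ} (hr : 0 < r) (k m : ℕ) : HasHardHypergraph r k m 1 := by
  obtain ⟨N, H, -, -, hu, hm, hd, -⟩ := exists_hypergraph_of_tuples (max k 1)
    (fun _ : Fin m × Fin r => (0 : Fin 1)) hr (by simp)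
  exact ⟨N, H, hu, hm, hd, fun R _ => by simp⟩

/-- Deviation and bad tuples cost `δ * m` each, and the separator bound doubles the sum to `4 * δ *
m`; the quotient makes this error relative. -/
theorem hasHardHypergraph_of_bounds {m r n k : ℕ} (hr : 2 ≤ r) (hn : 0 < n) (hk : 0 < k)
    (hm : 0 < m) {δ : ℝ} (hδ0 : 0 < δ) (hδ1 : δ ≤ 1)
    (hbad : (r : ℝ) ^ 2 / n + m * (r : ℝ) ^ 2 / (n : ℝ) ^ 2 + m * (r : ℝ) ^ 2 / (n * k) ≤ δ / 2)
    (hexp : (2 : ℝ) ^ n * Real.exp (-(δ ^ 2 * m / 4)) < 1 / 2) :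
    HasHardHypergraph r k m (4 * δ / (1 / 2 - separatorConst r)) := by
  classical
  have : Nonempty (Fin n) := ⟨⟨0, hn⟩⟩
  have hε : 0 < 1 / 2 - separatorConst r := sub_pos.2 (separatorConst_lt_half hr)
  obtain ⟨ω, hω1, hω2⟩ := exists_tuples hr hn hk hm hδ0 hδ1 hbad hexp
  obtain ⟨N, H, w, hV, hu, hE, hd, hS⟩ := exists_hypergraph_of_tuples k ω (by omega) hk
  refine ⟨N, H, hu, hE, hd.trans (le_max_left _ _), fun R hR => ?_⟩
  have hind : ∀ S : Set (Fin N),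
      ({e ∈ E(H) | e ⊆ S}.ncard : ℝ) ≤ (weight w S ^ r + 2 * δ) * E(H).ncard := by
    intro S
    have h1 : ({e ∈ E(H) | e ⊆ S}.ncard : ℝ) ≤
        tuplesIn ω (Finset.univ.filter fun x => w x ∈ S) +
          (Finset.univ.filter fun j => IsBadTuple k ω j).card := by exact_mod_cast hS S
    have h2 := hω2 (Finset.univ.filter fun x => w x ∈ S)
    have h3 : weight w S = ((Finset.univ.filter fun x => w x ∈ S).card : ℝ) / n := by
      unfold weight
      rw [← Set.ncard_coe_finset]
      simp [Set.preimage]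
    rw [h3, hE]
    linarith
  have := hR.le_ncard hr hV w (by positivity) hind
  rw [hE] at this
  refine le_trans (le_of_eq ?_) this
  rw [mul_one_sub, mul_right_comm, mul_div_cancel₀ _ hε.ne']
  ring

theorem exists_forall_hasHardHypergraph {r : ℕ} (hr : 2 ≤ r) {δ : ℝ} (hδ : 0 < δ) :
    ∃ K M : ℕ, ∀ k m : ℕ, K ≤ k → M ≤ m → HasHardHypergraph r k m δ := by
  have hε : 0 < 1 / 2 - separatorConst r := sub_pos.2 (separatorConst_lt_half hr)
  set c : ℝ := min 1 (δ * (1 / 2 - separatorConst r) / 4) with hc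
  have hc0 : 0 < c := lt_min one_pos (by positivity)
  have hc1 : c ≤ 1 := min_le_left _ _
  have hcδ : 4 * c / (1 / 2 - separatorConst r) ≤ δ := by
    rw [div_le_iff₀ hε]
    have := min_le_right 1 (δ * (1 / 2 - separatorConst r) / 4)
    linarith
  -- With `n = m / D` this gives `2 ^ n ≤ exp (c ^ 2 * m / 8)`, so the union bound is affordable.
  -- `K` and `M` make each of the three bad-tuple terms at most `c / 6`.
  obtain ⟨D, hD⟩ := exists_nat_ge (8 / c ^ 2)
  have hD0 : (0 : ℝ) < D := lt_of_lt_of_le (by positivity) hD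
  have hr0 : (0 : ℝ) < r := by positivity
  obtain ⟨K, hK⟩ := exists_nat_ge (12 * D * (r : ℝ) ^ 2 / c)
  obtain ⟨M, hM⟩ := exists_nat_ge (2 * D + 8 / c ^ 2 + 12 * D * (r : ℝ) ^ 2 / c +
    24 * D ^ 2 * (r : ℝ) ^ 2 / c)
  refine ⟨K, M, fun k m hk hm => ?_⟩
  have hk' : 12 * D * (r : ℝ) ^ 2 / c ≤ k := hK.trans (by exact_mod_cast hk)
  have hk0 : (0 : ℝ) < k := lt_of_lt_of_le (by positivity) hk'
  have hm' : 2 * D + 8 / c ^ 2 + 12 * D * (r : ℝ) ^ 2 / c + 24 * D ^ 2 * (r : ℝ) ^ 2 / c ≤ m :=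
    hM.trans (by exact_mod_cast hm)
  have p1 : 0 < 8 / c ^ 2 := by positivity
  have p2 : 0 < 12 * D * (r : ℝ) ^ 2 / c := by positivity
  have p3 : 0 < 24 * D ^ 2 * (r : ℝ) ^ 2 / c := by positivity
  have m1 : 2 * (D : ℝ) ≤ m := by linarith
  have m2 : 8 / c ^ 2 ≤ m := by linarith
  have m3 : 12 * D * (r : ℝ) ^ 2 / c ≤ m := by linarith
  have m4 : 24 * D ^ 2 * (r : ℝ) ^ 2 / c ≤ m := by linarith
  have hm0 : (0 : ℝ) < m := by linarith
  set n : ℕ := m / D with hn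
  have hnD : (n : ℝ) * D ≤ m := by exact_mod_cast Nat.div_mul_le_self m D
  have hnD' : (m : ℝ) ≤ 2 * D * n := by
    have : (m : ℝ) ≤ D * (n + 1) := by
      exact_mod_cast (Nat.lt_mul_div_succ m (by exact_mod_cast hD0)).le
    linarith
  have hn0 : (0 : ℝ) < n := by
    by_contra h
    have : (2 * D * n : ℝ) ≤ 0 := mul_nonpos_of_nonneg_of_nonpos (by positivity) (not_lt.1 h)
    linarith
  have hmn : (m : ℝ) / n ≤ 2 * D := by rwa [div_le_iff₀ hn0]
  have hinv : 1 / (n : ℝ) ≤ 2 * D / m := by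
    rw [div_le_div_iff₀ hn0 hm0]; linarith
  have b1 : (r : ℝ) ^ 2 / n ≤ c / 6 := by
    calc (r : ℝ) ^ 2 / n = (r : ℝ) ^ 2 * (1 / n) := by ring
      _ ≤ (r : ℝ) ^ 2 * (2 * D / m) := by gcongr
      _ ≤ c / 6 := by
        rw [← mul_div_assoc, div_le_iff₀ hm0]
        rw [div_le_iff₀ hc0] at m3
        linarith
  have b2 : m * (r : ℝ) ^ 2 / (n : ℝ) ^ 2 ≤ c / 6 := by
    calc m * (r : ℝ) ^ 2 / (n : ℝ) ^ 2 = (r : ℝ) ^ 2 * (m / n) * (1 / n) := by ring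
      _ ≤ (r : ℝ) ^ 2 * (2 * D) * (2 * D / m) := by gcongr
      _ ≤ c / 6 := by
        rw [← mul_div_assoc, div_le_iff₀ hm0]
        rw [div_le_iff₀ hc0] at m4
        linarith
  have b3 : m * (r : ℝ) ^ 2 / (n * k) ≤ c / 6 := by
    calc m * (r : ℝ) ^ 2 / (n * k) = (r : ℝ) ^ 2 * (m / n) / k := by field_simp
      _ ≤ (r : ℝ) ^ 2 * (2 * D) / k := by gcongr
      _ ≤ c / 6 := by
        rw [div_le_iff₀ hk0]
        rw [div_le_iff₀ hc0] at hk'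
        linarith
  have hexp : (2 : ℝ) ^ n * Real.exp (-(c ^ 2 * m / 4)) < 1 / 2 := by
    have h2 : (2 : ℝ) ≤ Real.exp 1 := by linarith [Real.add_one_le_exp (1 : ℝ)]
    have h3 : (n : ℝ) ≤ c ^ 2 * m / 8 := by
      rw [div_le_iff₀ (by positivity)] at hD
      have : (n : ℝ) * 8 ≤ n * (D * c ^ 2) := by gcongr
      have : (n : ℝ) * D * c ^ 2 ≤ m * c ^ 2 := by gcongr
      linarith
    have h4 : 1 ≤ c ^ 2 * m / 8 := by
      rw [div_le_iff₀ (by positivity)] at m2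
      linarith
    calc (2 : ℝ) ^ n * Real.exp (-(c ^ 2 * m / 4))
        ≤ Real.exp 1 ^ n * Real.exp (-(c ^ 2 * m / 4)) := by gcongr
      _ = Real.exp (n - c ^ 2 * m / 4) := by
        rw [← Real.exp_nat_mul, ← Real.exp_add]; ring_nf
      _ ≤ Real.exp (-1) := Real.exp_le_exp.2 (by linarith)
      _ < 1 / 2 := by
        rw [Real.exp_neg, one_div]
        exact inv_strictAnti₀ (by norm_num) (by linarith [Real.exp_one_gt_d9])
  obtain ⟨N, H, hu, hE, hd, hsep⟩ := hasHardHypergraph_of_bounds hr (by exact_mod_cast hn0)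
    (by exact_mod_cast hk0) (by exact_mod_cast hm0) hc0 hc1 (by linarith) hexp
  refine ⟨N, H, hu, hE, hd, fun R hR => le_trans ?_ (hsep R hR)⟩
  gcongr

/-! ### Diagonalisation and tightness -/

theorem exists_hard_hypergraphs {r : ℕ} (hr : 2 ≤ r) {k m : ℕ → ℕ} (hk : Tendsto k atTop atTop)
    (hm : Tendsto m atTop atTop) :
    ∃ (n : ℕ → ℕ) (H : ∀ i, Hypergraph (Fin (n i))) (δ : ℕ → ℝ),
      (∀ i, (H i).IsUniform r ∧ E(H i).ncard = m i) ∧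
      (∀ᶠ i in atTop, (H i).maxDegree ≤ k i) ∧
      Tendsto δ atTop (𝓝 0) ∧
      ∀ i, ∀ R, (H i).IsBalancedSeparator R →
        (1 / 2 - separatorConst r) * (m i : ℝ) * (1 - δ i) ≤ (R.ncard : ℝ) := by
  classical
  let Q : ℕ → ℕ → Prop := fun i j => HasHardHypergraph r (k i) (m i) (1 / ((j : ℝ) + 1))
  -- Each index takes the best precision `1 / (j + 1)` with `j ≤ i` available to it. Every fixed `j`
  -- is eventually available, so `J` tends to infinity.
  let J : ℕ → ℕ := fun i => Nat.findGreatest (Q i) i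
  have hJ : ∀ i, Q i (J i) := fun i => by
    refine Nat.findGreatest_spec (m := 0) (Nat.zero_le i) ?_
    simpa [Q] using hasHardHypergraph_one (by omega : 0 < r) (k i) (m i)
  have hJt : Tendsto J atTop atTop := by
    refine tendsto_atTop.2 fun j => ?_
    obtain ⟨K, M, h⟩ := exists_forall_hasHardHypergraph hr (δ := 1 / ((j : ℝ) + 1)) (by positivity)
    filter_upwards [hk.eventually_ge_atTop K, hm.eventually_ge_atTop M, eventually_ge_atTop j]
      with i h1 h2 h3
    exact Nat.le_findGreatest h3 (h _ _ h1 h2)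
  choose N H hu hE hd hsep using hJ
  refine ⟨N, H, fun i => 1 / ((J i : ℝ) + 1), fun i => ⟨hu i, hE i⟩, ?_, ?_, hsep⟩
  · filter_upwards [hk.eventually_ge_atTop 1] with i hi
    exact (hd i).trans (max_le le_rfl hi)
  · exact tendsto_one_div_add_atTop_nhds_zero_nat.comp hJt

theorem not_separatorBound {r : ℕ} (hr : 2 ≤ r) {ε : ℝ} (hε : separatorConst r < ε) :
    ¬ SeparatorBound r ε := by
  intro hbound
  -- With `k i = i` the maximum degree is eventually at most `i`, which is `o(i ^ 2) = o(√m)`.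
  have hm : Tendsto (fun i : ℕ => i ^ 4) atTop atTop := tendsto_pow_atTop (by norm_num)
  obtain ⟨n, H, δ, hH, hd, hδ, hsep⟩ := exists_hard_hypergraphs hr tendsto_id hm
  have hE : ∀ i, E(H i).ncard = i ^ 4 := fun i => (hH i).2
  obtain ⟨err, herr, hR⟩ := hbound n H (fun i e he => ((hH i).1 e he).le) (by simpa only [hE]) (by
    have hsqrt : ∀ i : ℕ, √((i ^ 4 : ℕ) : ℝ) = (i : ℝ) ^ 2 := fun i => by
      rw [show ((i ^ 4 : ℕ) : ℝ) = ((i : ℝ) ^ 2) ^ 2 by push_cast; ring]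
      exact Real.sqrt_sq (by positivity)
    simp only [hE, hsqrt]
    have h1 : (fun i => ((H i).maxDegree : ℝ)) =O[atTop] fun i : ℕ => (i : ℝ) := by
      refine IsBigO.of_bound 1 ?_
      filter_upwards [hd] with i hi
      simpa using hi
    refine h1.trans_isLittleO ?_
    have h2 := (isLittleO_pow_pow_atTop_of_lt (𝕜 := ℝ) (p := 1) (q := 2) (by norm_num)).comp_tendsto
      tendsto_natCast_atTop_atTop (k := (Nat.cast : ℕ → ℝ))
    simpa [Function.comp_def] using h2)
  choose R hRb hRc using hR
  have hlim1 : Tendsto (fun i => (1 / 2 - separatorConst r) * (1 - δ i)) atTop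
      (𝓝 ((1 / 2 - separatorConst r) * (1 - 0))) := (hδ.const_sub 1).const_mul _
  have hlim2 : Tendsto (fun i => (1 / 2 - ε) + err i / (E(H i).ncard : ℝ)) atTop
      (𝓝 ((1 / 2 - ε) + 0)) := herr.tendsto_div_nhds_zero.const_add _
  have hle := le_of_tendsto_of_tendsto hlim1 hlim2 (by
    filter_upwards [eventually_ge_atTop 1] with i hi
    have h1 := (hsep i (R i) (hRb i)).trans (hRc i)
    rw [hE] at h1 ⊢
    have hpos : (0 : ℝ) < ((i ^ 4 : ℕ) : ℝ) := by
      have : 0 < i := hi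
      positivity
    rw [← mul_le_mul_iff_left₀ hpos, add_mul, div_mul_cancel₀ _ hpos.ne']
    linarith)
  linarith

theorem mainTheorem4 (r : ℕ) (hr : 2 ≤ r) :
    (∃ C : ℝ, 0 < C ∧ ∀ k m : ℕ → ℕ,
      Tendsto k atTop atTop → Tendsto m atTop atTop →
      (fun i => (k i : ℝ)) =o[atTop] (fun i => (m i : ℝ)) →
      ∃ (n : ℕ → ℕ) (H : ∀ i, Hypergraph (Fin (n i))) (δ : ℕ → ℝ),
        (∀ i, (H i).IsUniform r ∧ E(H i).ncard = m i) ∧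
        (∀ᶠ i in atTop, ((H i).maxDegree : ℝ) ≤ C * (k i : ℝ)) ∧
        Tendsto δ atTop (𝓝 0) ∧
        ∀ i, ∀ R, (H i).IsBalancedSeparator R →
          (1 / 2 - separatorConst r) * (m i : ℝ) * (1 - δ i) ≤ (R.ncard : ℝ)) ∧
    (∀ ε : ℝ, separatorConst r < ε → ¬ SeparatorBound r ε) := by
  refine ⟨⟨1, one_pos, fun k m hk hm _ => ?_⟩, fun ε hε => not_separatorBound hr hε⟩
  obtain ⟨n, H, δ, hH, hd, hδ, hsep⟩ := exists_hard_hypergraphs hr hk hm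
  refine ⟨n, H, δ, hH, ?_, hδ, hsep⟩
  filter_upwards [hd] with i hi
  rw [one_mul]
  exact_mod_cast hi
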